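/- Let $P_n^\bullet$ ($n\ge 1$) be a once-punctured $n$-gon: a disc with $n$ marked points $v_0,\dots,v_{n-1}$ on its boundary and one marked point $\bullet$ (the puncture) in its interior. An arc is a non-self-intersecting curve whose endpoints are marked points, considered up to isotopy, that is neither contractible nor isotopic to a boundary edge; loops at a boundary vertex around the puncture are allowed. A spoke is an arc with one endpoint at $\bullet$. For $m\ge 1$, an $(m+2)$-angulation of $P_n^\bullet$ is a set $T$ of pairwise non-crossing arcs such that every connected component of $P_n^\bullet\setminus T$ is an $(m+2)$-gon. Here a $k$-gon is a component that is an open disc not containing $\bullet$ and whose boundary walk has $k$ corners; a marked point that is met several times on this walk is counted with multiplicity. Theorem. Let $m,\ell\ge 1$, $n=m\ell$ and $1\le s\le \ell$. The number of $(m+2)$-angulations of $P_n^\bullet$ with exactly $s$ spokes is $$m\binom{n+\ell-s-1}{n-1}.$$ -/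

import Mathlib

/-!
The once-punctured polygon: a disc with `n` marked points on the boundary, indexed clockwise by
`ZMod n`, and one marked point in the interior, the puncture.

Cutting the puncture out and passing to the universal cover gives an infinite strip: the boundary
vertices lift to the integers (the integer `a` lies above the vertex `a mod n`), the puncture
becomes a single point `⊤` at infinity, and the deck transformations are the translations by the
multiples of `n`.  An isotopy class of arcs is determined by the end points in
`WithTop ℤ` of any one of its lifts.
-/

namespace PuncturedPolygon

/-- Arcs of the once-punctured `n`-gon (`1 ≤ n`), up to isotopy, boundary edges not included.

* `chord i j` is the arc `(v_i, v_j)` between boundary vertices that has `v_{i+1}, …, v_{j-1}` on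
  the side without the puncture.  For `i = j` it is the loop at `v_i` around the puncture, with all
  other boundary vertices on the side without the puncture.  The pairs `(v_i, v_{i+1})` are the
  boundary edges; for `n = 1` this is the only loop there is.
* `spoke i` is the arc from `v_i` to the puncture. -/
inductive Arc (n : ℕ) : Type
  | chord (i j : ZMod n) (h : j ≠ i + 1) : Arc n
  | spoke (i : ZMod n) : Arc n

/-- `IsLift α p q`, with `p < q`: the arc `α` has a lift to the universal cover
with end points `p` and `q`. -/
def Arc.IsLift {n : ℕ} : Arc n → WithTop ℤ → WithTop ℤ → Prop
  | .chord i j _, p, q => ∃ a b : ℤ, p = (a : WithTop ℤ) ∧ q = (b : WithTop ℤ) ∧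
      (a : ZMod n) = i ∧ (b : ZMod n) = j ∧ a < b ∧ b ≤ a + n
  | .spoke i, p, q => ∃ a : ℤ, p = (a : WithTop ℤ) ∧ q = ⊤ ∧ (a : ZMod n) = i

/-- Two arcs cross (they have no disjoint representatives, end points aside) iff a lift of one and
a lift of the other have interleaving end points. -/
def Arc.Crosses {n : ℕ} (α β : Arc n) : Prop :=
  ∃ p q r s : WithTop ℤ, α.IsLift p q ∧ β.IsLift r s ∧
    ((p < r ∧ r < q ∧ q < s) ∨ (r < p ∧ p < s ∧ s < q))

/-- For `p < q`: the points `p` and `q` of the universal cover are joined by a lift of a boundary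
edge or by a lift of an arc that belongs to `T`. -/
def Joined {n : ℕ} (T : Set (Arc n)) (p q : WithTop ℤ) : Prop :=
  (∃ a : ℤ, p = (a : WithTop ℤ) ∧ q = ((a + 1 : ℤ) : WithTop ℤ)) ∨ ∃ α ∈ T, α.IsLift p q

/-- `V` is the set of corners of a lift of a polygon cut out by the arcs in `T`.  There are at least
three corners; any two corners that are neighbours in the cyclic order of `V` (that is,
consecutive in `V`, or the least and the greatest element of `V`) are joined by a side, which is
an arc in `T` or a boundary edge; and no arc in `T` is a diagonal, joining two corners that are
not neighbours.

For pairwise non-crossing `T`, the arcs in `T` then avoid the interior of the polygon, so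
its interior is a connected component of the complement of `T`; and every component that does not
contain the puncture arises in this way, from one `V` up to translation by multiples of `n`.
A marked point that is met twice on the boundary of a component counts as two corners: for
instance, if there is just one spoke `(v_i, •)`, then the component around the puncture is a polygon
with corners `v_i, …, v_i, •`. -/
def IsSubgon {n : ℕ} (T : Set (Arc n)) (V : Finset (WithTop ℤ)) : Prop :=
  3 ≤ V.card ∧ ∀ p ∈ V, ∀ q ∈ V, p < q →
    (Joined T p q ↔ (∀ r ∈ V, ¬ (p < r ∧ r < q)) ∨ (∀ r ∈ V, p ≤ r ∧ r ≤ q))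

/-- `T` is a set of pairwise non-crossing arcs of the once-punctured `n`-gon all of whose
complementary components are `k`-gons. -/
structure IsAngulation {n : ℕ} (k : ℕ) (T : Set (Arc n)) : Prop where
  noncrossing : ∀ α ∈ T, ∀ β ∈ T, ¬ α.Crosses β
  /-- No component contains the puncture (such a component would not be a polygon). -/
  puncture : ∃ i : ZMod n, Arc.spoke i ∈ T
  /-- Each of the components, which by the above are polygons, has `k` corners. -/
  card_eq : ∀ V : Finset (WithTop ℤ), IsSubgon T V → V.card = k

/-- The number of spokes in `T`. -/
noncomputable def numSpokes {n : ℕ} (T : Set (Arc n)) : ℕ :=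
  {i : ZMod n | Arc.spoke i ∈ T}.ncard

end PuncturedPolygon

/-! Lift to the strip over `ℤ` and let `f i` be the number of chords that start at `v_i`. An
angulation is determined by `f` and by the residue class modulo `m` shared by all its spokes; every
`f` with sum `ℓ - s` occurs with every class. Stars and bars counts the functions `f`, and the class
gives the factor `m`.

The dictionary is a height function with `h (x + 1) = h x + 1 - m * f x`. Let `N a` be the farthest
boundary point joined to `a`. The polygon just below an arc from `a` to `b` has corners `a, c, N c,
…, N^[m] c = b`, with `c` the neighbour of `a` preceding `b`; the polygon after a spoke at `x` has
corners `x, N x, …, N^[m] x` and the puncture. By induction on the length of arcs, `N` raises `h` by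
exactly one, and successive neighbours of `a` differ in height by `m` (`height_rel_aux`). Hence
joined pairs are the `Visible` pairs (`rel_iff_visible`), and spokes are the records of `h` in one
class modulo `m` (`spoke_iff`). From one spoke to the next `h` gains `m`, and over a period it gains
`n - m * ∑ f`, so `s = ℓ - ∑ f` (`numSpokes_add_sum`).

Conversely, if the gain over a period is positive, visible pairs and records in a class bound
polygons of the right size (`IsHeight.isFilled`). Since `m ∣ n`, the class is invariant under deck
transformations. -/

namespace PuncturedPolygon

/-! ### Iterates and neighbours in `ℤ`. -/

/-- Iterates of an increasing map that cannot jump over `b` reach `b`. -/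
theorem exists_iterate_eq {N : ℤ → ℤ} {P : ℤ → Prop} {b : ℤ}
    (h : ∀ x, P x → x < b → x < N x ∧ N x ≤ b ∧ P (N x)) {c : ℤ} (hc : P c) (hcb : c ≤ b) :
    ∃ t, N^[t] c = b := by
  obtain ⟨d, hd⟩ : ∃ d : ℕ, b - c ≤ d := ⟨(b - c).toNat, Int.self_le_toNat _⟩
  induction d generalizing c with
  | zero => exact ⟨0, by simp at hd ⊢; omega⟩
  | succ d ih =>
    rcases hcb.eq_or_lt with rfl | hlt
    · exact ⟨0, rfl⟩
    · obtain ⟨h1, h2, h3⟩ := h c hc hlt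
      obtain ⟨t, ht⟩ := ih h3 h2 (by push_cast at hd; omega)
      exact ⟨t + 1, by simpa [Function.iterate_succ_apply] using ht⟩

theorem strictMono_iterate {N : ℤ → ℤ} (h : ∀ x, x < N x) (c : ℤ) :
    StrictMono fun i : ℕ => N^[i] c :=
  strictMono_nat_of_lt_succ fun i => by
    simpa only [Function.iterate_succ_apply'] using h (N^[i] c)

theorem exists_next {W : Finset ℤ} {z q : ℤ} (hq : q ∈ W) (hz : z < q) :
    ∃ y ∈ W, z < y ∧ ∀ r ∈ W, z < r → y ≤ r := by
  obtain ⟨y, hy, hmin⟩ := (W.filter (z < ·)).exists_min_image id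
    ⟨q, Finset.mem_filter.2 ⟨hq, hz⟩⟩
  rw [Finset.mem_filter] at hy
  exact ⟨y, hy.1, hy.2, fun r hr hzr => hmin r (Finset.mem_filter.2 ⟨hr, hzr⟩)⟩

theorem exists_prev {W : Finset ℤ} {z q : ℤ} (hq : q ∈ W) (hz : q < z) :
    ∃ y ∈ W, y < z ∧ ∀ r ∈ W, r < z → r ≤ y := by
  obtain ⟨y, hy, hmax⟩ := (W.filter (· < z)).exists_max_image id
    ⟨q, Finset.mem_filter.2 ⟨hq, hz⟩⟩
  rw [Finset.mem_filter] at hy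
  exact ⟨y, hy.1, hy.2, fun r hr hzr => hmax r (Finset.mem_filter.2 ⟨hr, hzr⟩)⟩

/-! ### Laminations of the strip; polygon sizes expressed by iterates of `N`. -/

/-- The lift of a set of pairwise non-crossing arcs to the universal cover: `R a b` says that the
boundary points `a < b` are joined by an edge or an arc, and `S x` that there is a spoke at `x`. -/
structure IsLamination (n : ℕ) (R : ℤ → ℤ → Prop) (S : ℤ → Prop) : Prop where
  lt : ∀ {a b}, R a b → a < b
  le_add : ∀ {a b}, R a b → b ≤ a + n
  succ : ∀ a, R a (a + 1)
  le_of_lt : ∀ {a b c d}, R a b → R c d → a < c → c < b → d ≤ b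
  le_spoke : ∀ {a b x}, R a b → S x → a < x → b ≤ x
  rel_add : ∀ (k : ℤ) {a b}, R a b → R (a + k * n) (b + k * n)
  spoke_add : ∀ (k : ℤ) {x}, S x → S (x + k * n)

/-- `N a` is the greatest point joined to `a`. -/
structure IsOuter (R : ℤ → ℤ → Prop) (N : ℤ → ℤ) : Prop where
  rel : ∀ a, R a (N a)
  le : ∀ {a b}, R a b → b ≤ N a

/-- Corners of a polygon that does not have the puncture as a corner. -/
def IsGon (R : ℤ → ℤ → Prop) (W : Finset ℤ) : Prop :=
  3 ≤ W.card ∧ ∀ p ∈ W, ∀ q ∈ W, p < q →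
    (R p q ↔ (∀ r ∈ W, ¬ (p < r ∧ r < q)) ∨ ∀ r ∈ W, p ≤ r ∧ r ≤ q)

/-- Boundary corners of a polygon that has the puncture as a corner. -/
def IsSpokeGon (R : ℤ → ℤ → Prop) (S : ℤ → Prop) (W : Finset ℤ) : Prop :=
  2 ≤ W.card ∧ (∀ p ∈ W, ∀ q ∈ W, p < q → (R p q ↔ ∀ r ∈ W, ¬ (p < r ∧ r < q))) ∧
    ∀ p ∈ W, (S p ↔ (∀ r ∈ W, r ≤ p) ∨ ∀ r ∈ W, p ≤ r)

/-- The condition that all polygons have `m + 2` corners, in terms of the map `N`. -/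
structure IsFilled (m : ℕ) (R : ℤ → ℤ → Prop) (S : ℤ → Prop) (N : ℤ → ℤ) : Prop where
  iterate_eq : ∀ {a b c}, R a b → R a c → c < b → (∀ x, R a x → x < b → x ≤ c) → N^[m] c = b
  spoke_iterate : ∀ {x}, S x → S (N^[m] x)
  not_spoke_iterate : ∀ {x i}, S x → 0 < i → i < m → ¬ S (N^[i] x)

section

variable {n m : ℕ} {R : ℤ → ℤ → Prop} {S : ℤ → Prop} {N : ℤ → ℤ}

theorem IsLamination.exists_outer (hL : IsLamination n R S) : ∃ N, IsOuter R N := by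
  have : ∀ a, ∃ b, R a b ∧ ∀ x, R a x → x ≤ b := fun a =>
    Int.exists_greatest_of_bdd (P := R a) ⟨a + n, fun _ hz => hL.le_add hz⟩ ⟨a + 1, hL.succ a⟩
  choose N hN using this
  exact ⟨N, fun a => (hN a).1, fun {a b} h => (hN a).2 b h⟩

theorem IsOuter.lt (hL : IsLamination n R S) (hN : IsOuter R N) (x : ℤ) : x < N x :=
  hL.lt (hN.rel x)

/-- The corners are the `N`-orbit of `c` up to `b`. If `N x` were not a corner, it would lie
strictly between two neighbouring corners, and the side joining them would cross the arc from `x` to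
`N x`. -/
theorem IsLamination.chain (hL : IsLamination n R S) (hN : IsOuter R N) {W : Finset ℤ} {c b : ℤ}
    (hc : c ∈ W) (hcm : ∀ x ∈ W, c ≤ x) (hb : b ∈ W) (hbm : ∀ x ∈ W, x ≤ b)
    (hR : ∀ p ∈ W, ∀ q ∈ W, p < q → (R p q ↔ ∀ r ∈ W, ¬ (p < r ∧ r < q)))
    (hNb : ∀ x ∈ W, x < b → N x ≤ b) :
    ∃ t, N^[t] c = b ∧ W.card = t + 1 ∧ ∀ i ≤ t, N^[i] c ∈ W := by
  have hlt := hN.lt hL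
  have key : ∀ x ∈ W, x < b → N x ∈ W ∧ ∀ r ∈ W, x < r → N x ≤ r := by
    intro x hx hxb
    have hmem : N x ∈ W := by
      by_contra hmem
      obtain ⟨y, hy, hxy, hymin⟩ := exists_next hb hxb
      have hRy : R x y := (hR x hx y hy hxy).2 fun r hr h => by
        have := hymin r hr h.1; omega
      have hyN : y < N x := lt_of_le_of_ne (hN.le hRy) fun h => hmem (h ▸ hy)
      obtain ⟨p, hp, hpN, hpmax⟩ := exists_prev hy hyN
      obtain ⟨q, hq, hNq, hqmin⟩ := exists_next hb
        (lt_of_le_of_ne (hNb x hx hxb) fun h => hmem (h ▸ hb))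
      have hpq : R p q := (hR p hp q hq (hpN.trans hNq)).2 fun r hr h => by
        rcases lt_trichotomy r (N x) with h1 | h1 | h1
        · have := hpmax r hr h1; omega
        · exact hmem (h1 ▸ hr)
        · have := hqmin r hr h1; omega
      have := hpmax y hy hyN
      have := hL.le_of_lt (hN.rel x) hpq (by omega) hpN
      omega
    refine ⟨hmem, fun r hr hxr => ?_⟩
    have := (hR x hx _ hmem (hlt x)).1 (hN.rel x) r hr
    omega
  have hit : ∀ x ∈ W, ∃ t, N^[t] c = x := fun x hx =>
    exists_iterate_eq (P := (· ∈ W)) (fun y hy hyx =>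
      have h := key y hy (hyx.trans_le (hbm x hx))
      ⟨hlt y, h.2 x hx hyx, h.1⟩) hc (hcm x hx)
  have hmono := strictMono_iterate hlt c
  obtain ⟨t, ht⟩ := hit b hb
  have hmem : ∀ i ≤ t, N^[i] c ∈ W := by
    intro i
    induction i with
    | zero => exact fun _ => hc
    | succ i ih =>
      intro hi
      rw [Function.iterate_succ_apply']
      exact (key _ (ih (by omega)) (ht ▸ hmono (by omega : i < t))).1
  refine ⟨t, ht, ?_, hmem⟩
  have : W = (Finset.range (t + 1)).image fun i => N^[i] c := by
    ext x
    simp only [Finset.mem_image, Finset.mem_range]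
    constructor
    · intro hx
      obtain ⟨i, hi⟩ := hit x hx
      refine ⟨i, ?_, hi⟩
      have := hbm x hx
      rw [← hi, ← ht] at this
      have := hmono.le_iff_le.1 this
      omega
    · rintro ⟨i, hi, rfl⟩
      exact hmem i (by omega)
  rw [this, Finset.card_image_of_injective _ hmono.injective, Finset.card_range]

/-- The least corner `a` is set apart because `N a` may lie beyond the greatest corner `b`; the
remaining corners are kept under the side from `a` to `b` and form an `N`-chain. -/
theorem IsFilled.card_gon (hL : IsLamination n R S) (hN : IsOuter R N) (hF : IsFilled m R S N)
    {W : Finset ℤ} (hW : IsGon R W) : W.card = m + 2 := by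
  obtain ⟨hcard, hW⟩ := hW
  have hne : W.Nonempty := Finset.card_pos.1 (by omega)
  obtain ⟨a, ha, hamin⟩ := W.exists_min_image id hne
  obtain ⟨b, hb, hbmax⟩ := W.exists_max_image id hne
  simp only [id] at hamin hbmax
  have hcard' : (W.erase a).card = W.card - 1 := Finset.card_erase_of_mem ha
  obtain ⟨c, hc, hcmin⟩ := (W.erase a).exists_min_image id (Finset.card_pos.1 (by omega))
  simp only [id, Finset.mem_erase] at hc hcmin
  have hac : a < c := lt_of_le_of_ne (hamin c hc.2) (Ne.symm hc.1)
  have hcb : c < b := by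
    refine lt_of_le_of_ne (hbmax c hc.2) fun h => ?_
    have : W ⊆ {a, c} := fun x hx => by
      by_cases hxa : x = a
      · simp [hxa]
      · have := hcmin x ⟨hxa, hx⟩; have := hbmax x hx
        simp; omega
    have := (Finset.card_le_card this).trans Finset.card_le_two
    omega
  have hRab : R a b := (hW a ha b hb (hac.trans hcb)).2 (.inr fun r hr => ⟨hamin r hr, hbmax r hr⟩)
  have hRac : R a c := (hW a ha c hc.2 hac).2 (.inl fun r hr h => by
    have := hcmin r ⟨by omega, hr⟩; omega)
  have hR' : ∀ p ∈ W.erase a, ∀ q ∈ W.erase a, p < q →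
      (R p q ↔ ∀ r ∈ W.erase a, ¬ (p < r ∧ r < q)) := by
    intro p hp q hq hpq
    rw [Finset.mem_erase] at hp hq
    have hap := hamin p hp.2
    have := hp.1
    rw [hW p hp.2 q hq.2 hpq]
    constructor
    · rintro (h | h) r hr
      · exact h r (Finset.mem_of_mem_erase hr)
      · have := h a ha; omega
    · intro h
      refine .inl fun r hr hpr => h r (Finset.mem_erase.2 ⟨by omega, hr⟩) hpr
  obtain ⟨t, ht, htc, -⟩ := hL.chain hN (W := W.erase a) (c := c) (b := b)
    (Finset.mem_erase.2 hc) (fun x hx => hcmin x (Finset.mem_erase.1 hx))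
    (Finset.mem_erase.2 ⟨by omega, hb⟩) (fun x hx => hbmax x (Finset.mem_of_mem_erase hx)) hR'
    (fun x hx hxb => hL.le_of_lt hRab (hN.rel x)
      (hac.trans_le (hcmin x (Finset.mem_erase.1 hx))) hxb)
  have hmax : ∀ x, R a x → x < b → x ≤ c := by
    intro x hx hxb
    -- A neighbour `x` of `a` strictly between `c` and `b` is impossible: if it is not a corner, its
    -- arc crosses a side; if it is, its arc is a diagonal.
    by_contra! hcx
    have hxW : x ∈ W := by
      by_contra hxW
      obtain ⟨p, hp, hpx, hpmax⟩ := exists_prev hc.2 hcx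
      obtain ⟨q, hq, hxq, hqmin⟩ := exists_next hb hxb
      have hpq : R p q := (hW p hp q hq (hpx.trans hxq)).2 (.inl fun r hr h => by
        rcases lt_trichotomy r x with h1 | h1 | h1
        · have := hpmax r hr h1; omega
        · exact hxW (h1 ▸ hr)
        · have := hqmin r hr h1; omega)
      have := hL.le_of_lt hx hpq (hac.trans_le (hpmax c hc.2 hcx)) hpx
      omega
    rcases (hW a ha x hxW (hac.trans hcx)).1 hx with h | h
    · exact h c hc.2 ⟨hac, hcx⟩
    · have := h b hb; omega
  have := (strictMono_iterate (hN.lt hL) c).injective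
    ((hF.iterate_eq hRab hRac hcb hmax).trans ht.symm)
  omega

theorem IsFilled.card_spokeGon (hL : IsLamination n R S) (hN : IsOuter R N)
    (hF : IsFilled m R S N) (hm : 1 ≤ m) {W : Finset ℤ} (hW : IsSpokeGon R S W) :
    W.card = m + 1 := by
  obtain ⟨hcard, hW, hS⟩ := hW
  have hne : W.Nonempty := Finset.card_pos.1 (by omega)
  obtain ⟨a, ha, hamin⟩ := W.exists_min_image id hne
  obtain ⟨b, hb, hbmax⟩ := W.exists_max_image id hne
  simp only [id] at hamin hbmax
  have hSa : S a := (hS a ha).2 (.inr hamin)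
  have hSb : S b := (hS b hb).2 (.inl hbmax)
  obtain ⟨t, ht, htc, hmem⟩ := hL.chain hN ha hamin hb hbmax hW
    (fun x hx hxb => hL.le_spoke (hN.rel x) hSb hxb)
  have hmono := strictMono_iterate (hN.lt hL) a
  rcases lt_trichotomy t m with h | h | h
  · exact absurd (ht ▸ hSb) (hF.not_spoke_iterate hSa (by omega) h)
  · omega
  · exfalso
    have h1 : a < N^[m] a := hmono (show 0 < m by omega)
    have h2 : N^[m] a < b := ht ▸ hmono h
    rcases (hS _ (hmem m h.le)).1 (hF.spoke_iterate hSa) with h3 | h3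
    · have := h3 b hb; omega
    · have := h3 a ha; omega

/-- Each orbit segment in question is itself the corner set of a polygon, to which the size
hypotheses apply: from a spoke to the first spoke that the orbit meets, or from `c` to `b` with `a`
adjoined. -/
theorem isFilled_of_card (hL : IsLamination n R S) (hN : IsOuter R N) (hn : 1 ≤ n)
    (hG : ∀ W, IsGon R W → W.card = m + 2) (hG' : ∀ W, IsSpokeGon R S W → W.card = m + 1) :
    IsFilled m R S N := by
  have hlt := hN.lt hL
  have main : ∀ {x}, S x → 0 < m ∧ S (N^[m] x) ∧ ∀ i, 0 < i → i < m → ¬ S (N^[i] x) := by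
    intro x hx
    have hmono := strictMono_iterate hlt x
    have hS' : S (x + n) := by simpa using hL.spoke_add 1 hx
    -- The translate `x + n` carries a spoke, which `N` cannot jump over, so the orbit of `x` does
    -- meet a spoke again.
    obtain ⟨t₀, ht₀⟩ := exists_iterate_eq (N := N) (P := fun _ => True) (b := x + n) (c := x)
      (fun y _ hy => ⟨hlt y, hL.le_spoke (hN.rel y) hS' hy, trivial⟩) trivial (by omega)
    have hex : ∃ t, 0 < t ∧ S (N^[t] x) := by
      refine ⟨t₀, Nat.pos_of_ne_zero ?_, ht₀ ▸ hS'⟩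
      rintro rfl
      simp only [Function.iterate_zero, id] at ht₀
      omega
    classical
    obtain ⟨t, ⟨ht0, htS⟩, hmin⟩ : ∃ t, (0 < t ∧ S (N^[t] x)) ∧
        ∀ i, 0 < i → i < t → ¬ S (N^[i] x) :=
      ⟨Nat.find hex, Nat.find_spec hex, fun i hi hit h => Nat.find_min hex hit ⟨hi, h⟩⟩
    have hcard : ((Finset.range (t + 1)).image fun i => N^[i] x).card = t + 1 := by
      rw [Finset.card_image_of_injective _ hmono.injective, Finset.card_range]
    have := hG' ((Finset.range (t + 1)).image fun i => N^[i] x) ⟨by omega, ?_, ?_⟩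
    · obtain rfl : t = m := by omega
      exact ⟨ht0, htS, hmin⟩
    · simp only [Finset.mem_image, Finset.mem_range, forall_exists_index, and_imp,
        forall_apply_eq_imp_iff₂]
      intro i hi j hj hij
      replace hij := hmono.lt_iff_lt.1 hij
      constructor
      · intro h k hk hikj
        have h1 := hN.le h
        rw [← Function.iterate_succ_apply' N] at h1
        have h2 := hmono.le_iff_le.1 h1
        have h3 := hmono.lt_iff_lt.1 hikj.1
        have h4 := hmono.lt_iff_lt.1 hikj.2
        omega
      · intro h
        by_cases hj' : j = i + 1
        · rw [hj', Function.iterate_succ_apply']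
          exact hN.rel _
        · exact absurd ⟨hmono (by omega : i < i + 1), hmono (by omega : i + 1 < j)⟩
            (h (i + 1) (by omega))
    · simp only [Finset.mem_image, Finset.mem_range, forall_exists_index, and_imp,
        forall_apply_eq_imp_iff₂]
      intro i hi
      constructor
      · intro h
        by_cases hi0 : i = 0
        · subst hi0
          exact .inr fun j _ => hmono.le_iff_le.2 (Nat.zero_le j)
        · by_cases hit : i < t
          · exact absurd h (hmin i (by omega) hit)
          · exact .inl fun j hj => hmono.le_iff_le.2 (by omega)
      · rintro (h | h)
        · have := hmono.le_iff_le.1 (h t (by omega))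
          obtain rfl : i = t := by omega
          exact htS
        · have := hmono.le_iff_le.1 (h 0 (by omega))
          obtain rfl : i = 0 := by omega
          exact hx
  refine ⟨?_, fun hx => (main hx).2.1, fun hx => (main hx).2.2 _⟩
  intro a b c hab hac hcb hmax
  have hmono := strictMono_iterate hlt c
  have hlac := hL.lt hac
  obtain ⟨t, ht⟩ := exists_iterate_eq (N := N) (P := (a < ·)) (b := b) (c := c)
    (fun y hay hy => ⟨hlt y, hL.le_of_lt hab (hN.rel y) hay hy, hay.trans (hlt y)⟩) hlac hcb.le
  have ht0 : 0 < t := by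
    refine Nat.pos_of_ne_zero ?_
    rintro rfl
    exact hcb.ne ht
  have hage : ∀ i, a < N^[i] c := fun i => hlac.trans_le (hmono.le_iff_le.2 (Nat.zero_le i))
  have hnot : a ∉ (Finset.range (t + 1)).image fun i => N^[i] c := by
    simp only [Finset.mem_image, not_exists, not_and]
    exact fun i _ h => (hage i).ne' h
  have hcard : (insert a ((Finset.range (t + 1)).image fun i => N^[i] c)).card = t + 2 := by
    rw [Finset.card_insert_of_notMem hnot, Finset.card_image_of_injective _ hmono.injective,
      Finset.card_range]
  have := hG (insert a ((Finset.range (t + 1)).image fun i => N^[i] c)) ⟨by omega, ?_⟩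
  · obtain rfl : t = m := by omega
    exact ht
  · simp only [Finset.mem_insert, Finset.mem_image, Finset.mem_range, forall_eq_or_imp,
      forall_exists_index, and_imp, forall_apply_eq_imp_iff₂, lt_irrefl, false_imp_iff, true_and]
    refine ⟨fun j hj _ => ⟨fun h => ?_, ?_⟩, fun i hi => ⟨fun h => ?_, fun j hj hij => ⟨fun h => ?_, ?_⟩⟩⟩
    · by_cases hjt : j = t
      · subst hjt
        exact .inr ⟨⟨le_rfl, (hage _).le⟩, fun k hk =>
          ⟨(hage k).le, hmono.le_iff_le.2 (by omega)⟩⟩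
      · have hjb : N^[j] c < b := ht ▸ hmono (by omega : j < t)
        have := hmono.le_iff_le.1 (show N^[j] c ≤ N^[0] c from hmax _ h hjb)
        obtain rfl : j = 0 := by omega
        refine .inl ⟨by simp, fun k hk hk' => ?_⟩
        have := hmono.lt_iff_lt.1 hk'.2
        omega
    · rintro (h | h)
      · by_cases hj0 : j = 0
        · subst hj0; exact hac
        · exact absurd ⟨hage 0, hmono (by omega : 0 < j)⟩ (h.2 0 (by omega))
      · have := hmono.le_iff_le.1 (h.2 t (by omega)).2
        obtain rfl : j = t := by omega
        exact ht ▸ hab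
    · exact absurd h (hage i).not_gt
    · have h1 := hN.le h
      rw [← Function.iterate_succ_apply' N] at h1
      have h2 := hmono.le_iff_le.1 h1
      refine .inl ⟨fun h => absurd h.1 (hage i).not_gt, fun k hk h3 => ?_⟩
      have h4 := hmono.lt_iff_lt.1 h3.1
      have h5 := hmono.lt_iff_lt.1 h3.2
      omega
    · replace hij := hmono.lt_iff_lt.1 hij
      rintro (h | h)
      · by_cases hj' : j = i + 1
        · rw [hj', Function.iterate_succ_apply']
          exact hN.rel _
        · exact absurd ⟨hmono (by omega : i < i + 1), hmono (by omega : i + 1 < j)⟩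
            (h.2 (i + 1) (by omega))
      · exact absurd h.1.1 (hage i).not_ge

end

/-! ### Height functions and the laminations they define. -/

/-- A function on `ℤ` that goes up by at most one in each step, that is congruent to the identity
modulo `m`, and that gains `D` over each period `n`. -/
structure IsHeight (m n : ℕ) (D : ℤ) (h : ℤ → ℤ) : Prop where
  le_succ : ∀ x, h (x + 1) ≤ h x + 1
  dvd_sub_self : ∀ x, (m : ℤ) ∣ h x - x
  add_period : ∀ x, h (x + n) = h x + D

/-- The relation of being joined that is read off from a height function. -/
def Visible (m : ℕ) (h : ℤ → ℤ) (a b : ℤ) : Prop :=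
  a < b ∧ (∀ c, a < c → c < b → h c < h b) ∧ h b ≤ h a + 1 ∧ (m : ℤ) ∣ h a + 1 - h b

/-- Strict left-to-right maxima. -/
def IsRecord (h : ℤ → ℤ) (x : ℤ) : Prop := ∀ c < x, h c < h x

/-- The number of arcs that start at `a`. -/
noncomputable def outDegree (R : ℤ → ℤ → Prop) (a : ℤ) : ℕ := {b | a + 1 < b ∧ R a b}.ncard

section

variable {m n : ℕ} {D r : ℤ} {h : ℤ → ℤ}

theorem IsRecord.eq {x y : ℤ} (hx : IsRecord h x) (hy : IsRecord h y) (hxy : h x = h y) :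
    x = y := by
  rcases lt_trichotomy x y with h1 | h1 | h1
  · have := hy x h1; omega
  · exact h1
  · have := hx y h1; omega

namespace IsHeight

theorem add_mul (hH : IsHeight m n D h) (x k : ℤ) : h (x + k * n) = h x + k * D := by
  induction k with
  | zero => simp
  | succ k ih =>
    rw [show x + ((k : ℤ) + 1) * n = x + k * n + n by ring, hH.add_period, ih]; ring
  | pred k ih =>
    have := hH.add_period (x + (-(k : ℤ) - 1) * n)
    rw [show x + (-(k : ℤ) - 1) * n + n = x + -(k : ℤ) * n by ring, ih] at this
    linarith

theorem exists_ge (hH : IsHeight m n D h) (hD : 0 < D) (hn : 1 ≤ n) (a L : ℤ) :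
    ∃ d, a < d ∧ L ≤ h d := by
  refine ⟨a + (|L - h a| + 1) * n, ?_, ?_⟩
  · have := abs_nonneg (L - h a)
    have : (1 : ℤ) ≤ n := by exact_mod_cast hn
    nlinarith
  · rw [hH.add_mul]
    have := abs_nonneg (L - h a)
    have := le_abs_self (L - h a)
    nlinarith

/-- Discrete intermediate values: `h` is unbounded to the right and rises by at most one per step,
so its first point at level `L` or above is exactly at `L`. -/
theorem exists_hit (hH : IsHeight m n D h) (hD : 0 < D) (hn : 1 ≤ n) {a L : ℤ}
    (hL : h (a + 1) ≤ L) : ∃ b, a < b ∧ h b = L ∧ ∀ c, a < c → c < b → h c < L := by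
  obtain ⟨b, ⟨hab, hb⟩, hmin⟩ := Int.exists_least_of_bdd (P := fun d => a < d ∧ L ≤ h d)
    ⟨a, fun z hz => hz.1.le⟩ (hH.exists_ge hD hn a L)
  have hlt : ∀ c, a < c → c < b → h c < L := fun c hac hcb => by
    by_contra! hc
    have := hmin c ⟨hac, hc⟩
    omega
  refine ⟨b, hab, le_antisymm ?_ hb, hlt⟩
  by_cases hb1 : b = a + 1
  · rwa [hb1]
  · have h1 := hlt (b - 1) (by omega) (by omega)
    have h2 := hH.le_succ (b - 1)
    rw [sub_add_cancel] at h2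
    omega

theorem exists_record (hH : IsHeight m n D h) (hD : 0 < D) (hn : 1 ≤ n) (L : ℤ) :
    ∃ b, h b = L ∧ IsRecord h b := by
  have hn' : (0 : ℤ) < n := by exact_mod_cast hn
  obtain ⟨C, hC⟩ : ∃ C, ∀ i, 0 ≤ i → i < (n : ℤ) → h i ≤ C := by
    obtain ⟨z, -, hz⟩ := (Finset.Ico (0 : ℤ) n).exists_max_image h ⟨0, by simpa using hn'⟩
    exact ⟨h z, fun i h0 h1 => hz i (by simp [h0, h1])⟩
  obtain ⟨d, -, hd⟩ := hH.exists_ge hD hn 0 L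
  obtain ⟨b, hb, hmin⟩ := Int.exists_least_of_bdd (P := fun d => L ≤ h d)
    ⟨-|L - C| * n, fun z hz => by
      have h1 := hH.add_mul (z % n) (z / n)
      rw [mul_comm, Int.emod_add_mul_ediv] at h1
      have h2 := hC _ (Int.emod_nonneg z hn'.ne') (Int.emod_lt_of_pos z hn')
      have h3 : -|L - C| ≤ z / n := by
        by_contra! h3
        have := neg_abs_le (L - C)
        have := abs_nonneg (L - C)
        nlinarith
      have h4 := Int.emod_add_mul_ediv z n
      have h5 := Int.emod_nonneg z hn'.ne'
      nlinarith⟩ ⟨d, hd⟩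
  have hlt : ∀ c < b, h c < L := fun c hcb => by
    by_contra! hc
    have := hmin c hc
    omega
  have hbL : h b = L := by
    have h1 := hlt (b - 1) (by omega)
    have h2 := hH.le_succ (b - 1)
    rw [sub_add_cancel] at h2
    omega
  exact ⟨b, hbL, fun c hc => hbL ▸ hlt c hc⟩

/-- A crossing `a < c < b < d` would give `h c < h b < h d ≤ h c + 1`. An arc longer than `n` would
pass over `a + n`, which is higher than `a` and hence at least as high as its end. -/
theorem isLamination (hH : IsHeight m n D h) (hD : 0 < D) (hn : 1 ≤ n) (hmn : m ∣ n) (r : ℤ) :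
    IsLamination n (Visible m h) fun x => IsRecord h x ∧ (m : ℤ) ∣ x - r where
  lt hab := hab.1
  le_add {a b} hab := by
    by_contra! hb
    have h1 := hab.2.1 (a + n) (by omega) hb
    have h2 := hH.add_period a
    have h3 := hab.2.2.1
    omega
  succ a := by
    refine ⟨by omega, fun c _ _ => by omega, hH.le_succ a, ?_⟩
    have := dvd_sub (hH.dvd_sub_self a) (hH.dvd_sub_self (a + 1))
    rwa [show h a - a - (h (a + 1) - (a + 1)) = h a + 1 - h (a + 1) by ring] at this
  le_of_lt {a b c d} hab hcd hac hcb := by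
    by_contra! hbd
    have h1 := hab.2.1 c hac hcb
    have h2 := hcd.2.1 b hcb hbd
    have h3 := hcd.2.2.1
    omega
  le_spoke {a b x} hab hx hax := by
    by_contra! hxb
    have h1 := hx.1 a hax
    have h2 := hab.2.1 x hax hxb
    have h3 := hab.2.2.1
    omega
  rel_add k {a b} hab := by
    obtain ⟨h1, h2, h3, h4⟩ := hab
    refine ⟨by omega, fun c hac hcb => ?_, ?_, ?_⟩
    · have h5 := h2 (c - k * n) (by omega) (by omega)
      have h6 := hH.add_mul (c - k * n) k
      rw [sub_add_cancel] at h6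
      rw [hH.add_mul]
      omega
    · rw [hH.add_mul, hH.add_mul]; omega
    · rw [hH.add_mul, hH.add_mul]
      convert h4 using 1
      ring
  spoke_add k {x} hx := by
    refine ⟨fun c hc => ?_, ?_⟩
    · have h5 := hx.1 (c - k * n) (by omega)
      have h6 := hH.add_mul (c - k * n) k
      rw [sub_add_cancel] at h6
      rw [hH.add_mul]
      omega
    · rw [show x + k * n - r = x - r + k * n by ring]
      exact dvd_add hx.2 (Dvd.dvd.mul_left (Int.natCast_dvd_natCast.2 hmn) k)

theorem outer_eq (hH : IsHeight m n D h) (hD : 0 < D) (hn : 1 ≤ n) {N : ℤ → ℤ}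
    (hN : IsOuter (Visible m h) N) (x : ℤ) : h (N x) = h x + 1 := by
  obtain ⟨b, hxb, hb, hlt⟩ := hH.exists_hit hD hn (hH.le_succ x)
  have h1 : b ≤ N x := hN.le ⟨hxb, fun c h1 h2 => hb ▸ hlt c h1 h2, by omega, by simp [hb]⟩
  have h2 := hN.rel x
  rcases h1.eq_or_lt with h3 | h3
  · rw [← h3, hb]
  · have := h2.2.1 b hxb h3
    have := h2.2.2.1
    omega

theorem iterate_outer_eq (hH : IsHeight m n D h) (hD : 0 < D) (hn : 1 ≤ n) {N : ℤ → ℤ}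
    (hN : IsOuter (Visible m h) N) (x : ℤ) (i : ℕ) : h (N^[i] x) = h x + i := by
  induction i with
  | zero => simp
  | succ i ih =>
    rw [Function.iterate_succ_apply', hH.outer_eq hD hn hN, ih]; push_cast; ring

/-- `N` raises `h` by one, preserves records and, as `h x ≡ x`, shifts residues modulo `m` by one;
so an orbit of records returns to the class of `r` exactly every `m` steps. -/
theorem isFilled (hH : IsHeight m n D h) (hD : 0 < D) (hn : 1 ≤ n) (hm : 1 ≤ m) (hmn : m ∣ n)
    (r : ℤ) {N : ℤ → ℤ} (hN : IsOuter (Visible m h) N) :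
    IsFilled m (Visible m h) (fun x => IsRecord h x ∧ (m : ℤ) ∣ x - r) N := by
  have hL := hH.isLamination hD hn hmn r
  have hm' : (1 : ℤ) ≤ m := by exact_mod_cast hm
  have hrec : ∀ x, IsRecord h x → ∀ i, IsRecord h (N^[i] x) := by
    intro x hx i
    induction i with
    | zero => exact hx
    | succ i ih =>
      rw [Function.iterate_succ_apply']
      intro c hc
      have h1 := hN.rel (N^[i] x)
      have h2 := hH.outer_eq hD hn hN (N^[i] x)
      rcases lt_trichotomy c (N^[i] x) with h3 | h3 | h3
      · have := ih c h3; omega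
      · rw [h3]; omega
      · exact h1.2.1 c h3 hc
  have hmod : ∀ x i, (m : ℤ) ∣ x - r → ((m : ℤ) ∣ N^[i] x - r ↔ (m : ℤ) ∣ i) := by
    intro x i hx
    have h1 := hH.iterate_outer_eq hD hn hN x i
    have h2 := hH.dvd_sub_self (N^[i] x)
    have h3 := hH.dvd_sub_self x
    have h4 : N^[i] x - r = i + ((x - r) + (h x - x) - (h (N^[i] x) - N^[i] x)) := by omega
    rw [h4]
    exact Int.dvd_add_left (dvd_sub (dvd_add hx h3) h2)
  refine ⟨?_, ?_, ?_⟩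
  · intro a b c hab hac hcb hmax
    have hlac := hac.1
    have hdvd : ∀ x, Visible m h a x → x < b → h x ≤ h b - m := by
      intro x hx hxb
      have h1 := hab.2.1 x hx.1 hxb
      have h2 := dvd_sub hx.2.2.2 hab.2.2.2
      rw [show h a + 1 - h x - (h a + 1 - h b) = h b - h x by ring] at h2
      have := Int.le_of_dvd (by omega) h2
      omega
    -- The first point after `a` at level `h b - m` is visible from `a`; this forces `h c = h b -
    -- m`, so `m` steps of `N` climb from `c` to the level of `b`.
    obtain ⟨x, hax, hx, hxlt⟩ := hH.exists_hit hD hn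
      (hdvd (a + 1) (hL.succ a) (by omega))
    have hxb : x < b := by
      by_contra! hbx
      rcases hbx.eq_or_lt with h1 | h1
      · rw [← h1] at hx; omega
      · have := hxlt b hab.1 h1; omega
    have hvx : Visible m h a x := by
      refine ⟨hax, fun c h1 h2 => hx ▸ hxlt c h1 h2, ?_, ?_⟩
      · have := hab.2.2.1; omega
      · rw [hx, show h a + 1 - (h b - m) = h a + 1 - h b + m by ring]
        exact dvd_add hab.2.2.2 (dvd_refl _)
    have hxc := hmax x hvx hxb
    have hc : h c = h b - m := by
      refine le_antisymm (hdvd c hac hcb) ?_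
      rcases hxc.eq_or_lt with h1 | h1
      · rw [← h1, hx]
      · have := hac.2.1 x hax h1; omega
    have hle : ∀ i ≤ m, N^[i] c ≤ b := by
      intro i
      induction i with
      | zero => exact fun _ => hcb.le
      | succ i ih =>
        intro hi
        rw [Function.iterate_succ_apply']
        refine hL.le_of_lt hab (hN.rel _) ?_ ?_
        · exact hlac.trans_le ((strictMono_iterate (hN.lt hL) c).le_iff_le.2 (Nat.zero_le i))
        · refine lt_of_le_of_ne (ih (by omega)) fun h1 => ?_
          have := hH.iterate_outer_eq hD hn hN c i
          rw [h1] at this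
          omega
    have h1 := hH.iterate_outer_eq hD hn hN c m
    refine (hle m le_rfl).eq_or_lt.resolve_right fun h2 => ?_
    have := hab.2.1 (N^[m] c)
      (hlac.trans_le ((strictMono_iterate (hN.lt hL) c).le_iff_le.2 (Nat.zero_le m))) h2
    omega
  · exact fun {x} hx => ⟨hrec x hx.1 m, (hmod x m hx.2).2 (dvd_refl _)⟩
  · intro x i hx hi him hS
    have := Int.le_of_dvd (by omega) ((hmod x i hx.2).1 hS.2)
    omega

theorem exists_spoke (hH : IsHeight m n D h) (hD : 0 < D) (hn : 1 ≤ n) (r : ℤ) :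
    ∃ x, IsRecord h x ∧ (m : ℤ) ∣ x - r := by
  obtain ⟨x, hx, hrec⟩ := hH.exists_record hD hn r
  refine ⟨x, hrec, ?_⟩
  have := hH.dvd_sub_self x
  rw [hx] at this
  rwa [← dvd_neg, neg_sub]

/-- The arcs from `a` end at the first hits of the levels `h (a + 1) + m * (j + 1)` for `j < k`, the
top level being `h a + 1`. -/
theorem outDegree_visible (hH : IsHeight m n D h) (hD : 0 < D) (hn : 1 ≤ n) (hm : 1 ≤ m) {a : ℤ}
    {k : ℕ} (hk : h (a + 1) = h a + 1 - m * k) : outDegree (Visible m h) a = k := by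
  have hm' : (0 : ℤ) < m := by exact_mod_cast hm
  have : ∀ j : ℕ, ∃ b, a < b ∧ h b = h (a + 1) + m * (j + 1) ∧
      ∀ c, a < c → c < b → h c < h (a + 1) + m * (j + 1) := fun j =>
    hH.exists_hit hD hn (by nlinarith)
  choose e he1 he2 he3 using this
  have himage : {b | a + 1 < b ∧ Visible m h a b} = e '' (Finset.range k) := by
    ext b
    simp only [Set.mem_ofPred_eq, Set.mem_image, Finset.coe_range, Set.mem_Iio]
    constructor
    · rintro ⟨hab, hb⟩
      have h1 := hb.2.1 (a + 1) (by omega) hab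
      have h2 := hb.2.2.2
      rw [show h a + 1 - h b = m * k - (h b - h (a + 1)) by rw [hk]; ring] at h2
      obtain ⟨q, hq⟩ := (Int.dvd_iff_dvd_of_dvd_sub h2).1 (Dvd.intro _ rfl)
      have hq0 : 0 < q := by
        by_contra! hq0
        nlinarith
      have hqk : q ≤ k := by
        have := hb.2.2.1
        by_contra! hqk
        nlinarith
      obtain ⟨j, hj⟩ := Int.eq_ofNat_of_zero_le (by omega : 0 ≤ q - 1)
      have hbe : h (e j) = h b := by
        rw [he2, ← hj]; linarith
      refine ⟨j, by omega, ?_⟩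
      rcases lt_trichotomy (e j) b with h3 | h3 | h3
      · have := hb.2.1 (e j) (he1 j) h3; omega
      · exact h3
      · have := he3 j b hb.1 h3; rw [← he2] at this; omega
    · rintro ⟨j, hj, rfl⟩
      have h1 : e j ≠ a + 1 := fun h1 => by
        have := he2 j
        rw [h1] at this
        nlinarith
      refine ⟨lt_of_le_of_ne (he1 j) h1.symm, he1 j, fun c hc hc' => he2 j ▸ he3 j c hc hc', ?_, ?_⟩
      · rw [he2, hk]
        have : ((j : ℤ) + 1) ≤ k := by exact_mod_cast hj
        nlinarith
      · rw [he2, hk]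
        exact ⟨k - (j + 1), by ring⟩
  rw [outDegree, himage, Set.ncard_image_of_injective, Set.ncard_coe_finset, Finset.card_range]
  intro i j hij
  have h1 := he2 i
  rw [hij, he2 j] at h1
  have h2 := mul_left_cancel₀ hm'.ne' (add_left_cancel h1)
  exact_mod_cast (add_right_cancel h2).symm

end IsHeight

end

/-! ### From a filled lamination back to its height function. -/

section

variable {m n : ℕ} {R : ℤ → ℤ → Prop} {S : ℤ → Prop} {N : ℤ → ℤ} {h : ℤ → ℤ} {D : ℤ}

theorem IsLamination.finite_rel (hL : IsLamination n R S) (a : ℤ) : {x | R a x}.Finite :=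
  (Set.finite_Icc a (a + n)).subset fun _ hx => ⟨(hL.lt hx).le, hL.le_add hx⟩

namespace IsFilled

/-- Induction on `b - a` through the polygon below the arc: its other sides are shorter, each of the
`m` steps of `N` from `c` to `b` climbs by one, and nothing under a side reaches the height of its
right end. -/
theorem height_rel_aux (hF : IsFilled m R S N) (hL : IsLamination n R S) (hN : IsOuter R N)
    (hh : ∀ x, h (x + 1) = h x + 1 - m * outDegree R x) {a b : ℤ} (hab : R a b) :
    (∀ c, a < c → c < b → h c < h b) ∧
      h b = h (a + 1) + m * {x | a + 1 < x ∧ x ≤ b ∧ R a x}.ncard := by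
  obtain ⟨d, hd⟩ : ∃ d : ℕ, b - a ≤ d := ⟨(b - a).toNat, Int.self_le_toNat _⟩
  induction d generalizing a b with
  | zero => have := hL.lt hab; simp at hd; omega
  | succ d ih =>
    have hlt := hN.lt hL
    have hlab := hL.lt hab
    by_cases hb : b = a + 1
    · subst hb
      refine ⟨fun c _ _ => by omega, ?_⟩
      have : {x | a + 1 < x ∧ x ≤ a + 1 ∧ R a x} = ∅ := by
        ext x; simp only [Set.mem_ofPred_eq, Set.mem_empty_iff_false, iff_false]; omega
      simp [this]
    obtain ⟨c, ⟨hac, hcb⟩, hmax⟩ := Int.exists_greatest_of_bdd (P := fun x => R a x ∧ x < b)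
      ⟨b, fun z hz => hz.2.le⟩ ⟨a + 1, hL.succ a, by omega⟩
    have hlac := hL.lt hac
    have hNm := hF.iterate_eq hab hac hcb fun x hx hxb => hmax x ⟨hx, hxb⟩
    obtain ⟨ih1, ih2⟩ := ih hac (by push_cast at hd; omega)
    have hmono := strictMono_iterate hlt c
    have hcount : {x | a + 1 < x ∧ x ≤ b ∧ R a x}.ncard =
        {x | a + 1 < x ∧ x ≤ c ∧ R a x}.ncard + 1 := by
      rw [← Set.ncard_insert_of_notMem (a := b) (fun hb => by have := hb.2.1; omega)
        ((hL.finite_rel a).subset fun _ hx => hx.2.2)]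
      congr 1
      ext x
      simp only [Set.mem_ofPred_eq, Set.mem_insert_iff]
      constructor
      · rintro ⟨h1, h2, h3⟩
        rcases h2.eq_or_lt with h4 | h4
        · exact .inl h4
        · exact .inr ⟨h1, hmax x ⟨h3, h4⟩, h3⟩
      · rintro (h1 | ⟨h1, h2, h3⟩)
        · subst h1; exact ⟨by omega, le_rfl, hab⟩
        · exact ⟨h1, by omega, h3⟩
    have hpath : ∀ i ≤ m, h (N^[i] c) = h c + i ∧ ∀ z, a < z → z < N^[i] c → h z < h (N^[i] c) := by
      intro i
      induction i with
      | zero => exact fun _ => ⟨by simp, ih1⟩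
      | succ i ihi =>
        intro hi
        obtain ⟨h1, h2⟩ := ihi (by omega)
        have h3 : N^[i] c < b := hNm ▸ hmono (by omega : i < m)
        have h4 : c ≤ N^[i] c := hmono.le_iff_le.2 (Nat.zero_le i)
        rw [Function.iterate_succ_apply']
        set y := N^[i] c with hy
        have h5 : N y ≤ b := hL.le_of_lt hab (hN.rel y) (by omega) h3
        obtain ⟨h6, h7⟩ := ih (hN.rel y) (by push_cast at hd; omega)
        have h8 : {x | y + 1 < x ∧ x ≤ N y ∧ R y x}.ncard = outDegree R y := by
          rw [outDegree]
          congr 1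
          ext x
          simp only [Set.mem_ofPred_eq]
          exact ⟨fun h => ⟨h.1, h.2.2⟩, fun h => ⟨h.1, hN.le h.2, h.2⟩⟩
        have h9 : h (N y) = h y + 1 := by
          rw [h7, h8, hh]; ring
        refine ⟨by rw [h9, h1]; push_cast; ring, fun z hz hzN => ?_⟩
        rcases lt_trichotomy z y with h10 | h10 | h10
        · have := h2 z hz h10; omega
        · rw [h10]; omega
        · exact h6 z h10 hzN
    obtain ⟨h1, h2⟩ := hpath m le_rfl
    rw [hNm] at h1 h2
    refine ⟨h2, ?_⟩
    rw [h1, ih2, hcount]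
    push_cast
    ring

theorem height_outer (hF : IsFilled m R S N) (hL : IsLamination n R S) (hN : IsOuter R N)
    (hh : ∀ x, h (x + 1) = h x + 1 - m * outDegree R x) (x : ℤ) : h (N x) = h x + 1 := by
  have h1 : {y | x + 1 < y ∧ y ≤ N x ∧ R x y}.ncard = outDegree R x := by
    rw [outDegree]
    congr 1
    ext y
    simp only [Set.mem_ofPred_eq]
    exact ⟨fun h => ⟨h.1, h.2.2⟩, fun h => ⟨h.1, hN.le h.2, h.2⟩⟩
  rw [(hF.height_rel_aux hL hN hh (hN.rel x)).2, h1, hh]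
  ring

theorem height_iterate (hF : IsFilled m R S N) (hL : IsLamination n R S) (hN : IsOuter R N)
    (hh : ∀ x, h (x + 1) = h x + 1 - m * outDegree R x) (x : ℤ) (i : ℕ) :
    h (N^[i] x) = h x + i := by
  induction i with
  | zero => simp
  | succ i ih =>
    rw [Function.iterate_succ_apply', hF.height_outer hL hN hh, ih]; push_cast; ring

theorem visible (hF : IsFilled m R S N) (hL : IsLamination n R S) (hN : IsOuter R N)
    (hh : ∀ x, h (x + 1) = h x + 1 - m * outDegree R x) {a b : ℤ} (hab : R a b) :
    Visible m h a b := by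
  obtain ⟨h1, h2⟩ := hF.height_rel_aux hL hN hh hab
  refine ⟨hL.lt hab, h1, ?_, ?_⟩
  · have h3 : {x | a + 1 < x ∧ x ≤ b ∧ R a x}.ncard ≤ outDegree R a :=
      Set.ncard_le_ncard (fun x hx => ⟨hx.1, hx.2.2⟩)
        ((hL.finite_rel a).subset fun _ hx => hx.2)
    have h4 : (m : ℤ) * ({x | a + 1 < x ∧ x ≤ b ∧ R a x}.ncard : ℤ) ≤ m * outDegree R a := by
      exact_mod_cast Nat.mul_le_mul_left m h3
    have h5 := hh a
    omega
  · rw [h2, hh, show h a + 1 - (h a + 1 - m * (outDegree R a : ℤ) +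
      m * ({x | a + 1 < x ∧ x ≤ b ∧ R a x}.ncard : ℤ)) =
      m * (outDegree R a - {x | a + 1 < x ∧ x ≤ b ∧ R a x}.ncard) by ring]
    exact dvd_mul_right _ _

/-- Joined points are visible, and both relations have the same finite out-degree at `a`, so they
agree. -/
theorem rel_iff_visible (hF : IsFilled m R S N) (hL : IsLamination n R S) (hN : IsOuter R N)
    (hh : ∀ x, h (x + 1) = h x + 1 - m * outDegree R x) (hH : IsHeight m n D h) (hD : 0 < D)
    (hn : 1 ≤ n) (hm : 1 ≤ m) (hmn : m ∣ n) {a b : ℤ} : R a b ↔ Visible m h a b := by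
  refine ⟨hF.visible hL hN hh, fun hab => ?_⟩
  -- The class `0` is arbitrary; only the finiteness of visible neighbours is used.
  have hV := hH.isLamination hD hn hmn 0
  by_cases hb : b = a + 1
  · exact hb ▸ hL.succ a
  have := Set.eq_of_subset_of_ncard_le (s := {b | a + 1 < b ∧ R a b})
    (t := {b | a + 1 < b ∧ Visible m h a b}) (fun x hx => ⟨hx.1, hF.visible hL hN hh hx.2⟩)
    (hH.outDegree_visible hD hn hm (hh a)).le ((hV.finite_rel a).subset fun _ hx => hx.2)
  have hmem : b ∈ {b | a + 1 < b ∧ R a b} := this ▸ ⟨by have := hab.1; omega, hab⟩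
  exact hmem.2

theorem isRecord (hF : IsFilled m R S N) (hL : IsLamination n R S) (hN : IsOuter R N)
    (hh : ∀ x, h (x + 1) = h x + 1 - m * outDegree R x) (hn : 1 ≤ n) {y : ℤ} (hy : S y) :
    IsRecord h y := by
  intro c hc
  have hlt := hN.lt hL
  have hn' : (1 : ℤ) ≤ n := by exact_mod_cast hn
  -- A starting point to the left of `c`. Its `N`-orbit cannot jump over the spoke at `y`, so it
  -- climbs to `y`, with everything under its steps lower.
  have hxc : y + (-(y - c)) * n ≤ c := by nlinarith
  generalize y + (-(y - c)) * n = x at hxc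
  obtain ⟨t, rfl⟩ := exists_iterate_eq (N := N) (P := fun _ => True) (b := y) (c := x)
    (fun z _ hz => ⟨hlt z, hL.le_spoke (hN.rel z) hy hz, trivial⟩) trivial (by omega)
  have : ∀ i z, x ≤ z → z < N^[i] x → h z < h (N^[i] x) := by
    intro i
    induction i with
    | zero => intro z h1 h2; simp at h2; omega
    | succ i ih =>
      intro z h1 h2
      rw [Function.iterate_succ_apply'] at h2 ⊢
      have h3 := hF.height_outer hL hN hh (N^[i] x)
      rcases lt_trichotomy z (N^[i] x) with h4 | h4 | h4
      · have := ih z h1 h4; omega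
      · rw [h4]; omega
      · exact (hF.height_rel_aux hL hN hh (hN.rel _)).1 z h4 h2
  exact this t c hxc hc

theorem iterate_le_spoke (hF : IsFilled m R S N) (hL : IsLamination n R S) (hN : IsOuter R N)
    {x y : ℤ} (hx : S x) (hy : S y) (hxy : x < y) : N^[m] x ≤ y := by
  have hlt := hN.lt hL
  obtain ⟨t, rfl⟩ := exists_iterate_eq (N := N) (P := fun _ => True) (b := y) (c := x)
    (fun z _ hz => ⟨hlt z, hL.le_spoke (hN.rel z) hy hz, trivial⟩) trivial hxy.le
  refine (strictMono_iterate hlt x).le_iff_le.2 ?_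
  by_contra! htm
  refine hF.not_spoke_iterate hx (Nat.pos_of_ne_zero ?_) htm hy
  rintro rfl
  exact hxy.ne rfl

theorem exists_iterate_spoke (hF : IsFilled m R S N) (hL : IsLamination n R S)
    (hN : IsOuter R N) (hm : 1 ≤ m) {x y : ℤ} (hx : S x) (hy : S y) (hxy : x ≤ y) :
    ∃ t, (N^[m])^[t] x = y :=
  exists_iterate_eq (P := S) (fun z hz hzy => ⟨strictMono_iterate (hN.lt hL) z (by omega : 0 < m),
    hF.iterate_le_spoke hL hN hz hy hzy, hF.spoke_iterate hz⟩) hx hxy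

theorem spoke_iterate_iterate (hF : IsFilled m R S N) {x : ℤ} (hx : S x) (t : ℕ) :
    S ((N^[m])^[t] x) := by
  induction t with
  | zero => exact hx
  | succ t ih => rw [Function.iterate_succ_apply']; exact hF.spoke_iterate ih

/-- The spokes from `x` on form the orbit of `N^[m]`. If `x + n` is reached after `t` steps, one
period contains `t` spokes and `h` has gained `m * t`. -/
theorem ncard_spokes (hF : IsFilled m R S N) (hL : IsLamination n R S) (hN : IsOuter R N)
    (hh : ∀ x, h (x + 1) = h x + 1 - m * outDegree R x) (hH : IsHeight m n D h) (hn : 1 ≤ n)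
    (hm : 1 ≤ m) {x : ℤ} (hx : S x) :
    D = m * {i : ZMod n | ∃ y : ℤ, (y : ZMod n) = i ∧ S y}.ncard ∧ 0 < D := by
  have hn' : (1 : ℤ) ≤ n := by exact_mod_cast hn
  have hm' : (1 : ℤ) ≤ m := by exact_mod_cast hm
  have hxn : S (x + n) := by simpa using hL.spoke_add 1 hx
  have hmono := strictMono_iterate (N := N^[m])
    (fun z => strictMono_iterate (hN.lt hL) z (by omega : 0 < m)) x
  obtain ⟨t, ht⟩ := hF.exists_iterate_spoke hL hN hm hx hxn (by omega)
  have hDt : D = m * t := by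
    have h1 := hH.add_period x
    rw [← ht, ← Function.iterate_mul, hF.height_iterate hL hN hh] at h1
    push_cast at h1
    linarith
  have ht0 : t ≠ 0 := by
    rintro rfl
    simp at ht
    omega
  have hset : {i : ZMod n | ∃ y : ℤ, (y : ZMod n) = i ∧ S y} =
      (fun i : ℕ => (((N^[m])^[i] x : ℤ) : ZMod n)) '' (Finset.range t) := by
    ext i
    simp only [Set.mem_ofPred_eq, Set.mem_image, Finset.coe_range, Set.mem_Iio]
    constructor
    · rintro ⟨y, rfl, hy⟩
      have h1 := Int.emod_add_mul_ediv (y - x) n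
      have h2 := Int.emod_nonneg (y - x) (show (n : ℤ) ≠ 0 by omega)
      have h3 := Int.emod_lt_of_pos (y - x) (show (0 : ℤ) < n by omega)
      obtain ⟨j, hj⟩ := hF.exists_iterate_spoke hL hN hm hx (hL.spoke_add (-((y - x) / n)) hy)
        (by linarith)
      refine ⟨j, hmono.lt_iff_lt.1 ?_, ?_⟩
      · simp only [hj, ht]
        linarith
      · rw [hj]
        simp
    · rintro ⟨j, -, rfl⟩
      exact ⟨_, rfl, hF.spoke_iterate_iterate hx j⟩
  have hinj : Set.InjOn (fun i : ℕ => (((N^[m])^[i] x : ℤ) : ZMod n)) (Finset.range t) := by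
    intro i hi j hj hij
    simp only [Finset.coe_range, Set.mem_Iio] at hi hj
    have h1 := hmono.lt_iff_lt.2 hi
    have h2 := hmono.lt_iff_lt.2 hj
    have h3 := hmono.le_iff_le.2 (Nat.zero_le i)
    have h4 := hmono.le_iff_le.2 (Nat.zero_le j)
    simp only [ht, Function.iterate_zero, id] at h1 h2 h3 h4
    have h5 := (ZMod.intCast_eq_intCast_iff_dvd_sub _ _ _).1 hij
    have h6 := Int.eq_zero_of_abs_lt_dvd h5 (by rw [abs_lt]; constructor <;> linarith)
    exact hmono.injective (show (N^[m])^[i] x = (N^[m])^[j] x by linarith)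
  rw [hset, hinj.ncard_image, Set.ncard_coe_finset, Finset.card_range]
  refine ⟨hDt, ?_⟩
  have : (1 : ℤ) ≤ t := by exact_mod_cast Nat.pos_of_ne_zero ht0
  rw [hDt]
  positivity

theorem spoke_iff (hF : IsFilled m R S N) (hL : IsLamination n R S) (hN : IsOuter R N)
    (hh : ∀ x, h (x + 1) = h x + 1 - m * outDegree R x) (hH : IsHeight m n D h) (hn : 1 ≤ n)
    (hm : 1 ≤ m) (hmn : m ∣ n) {r : ℤ} (hr : S r) {y : ℤ} :
    S y ↔ IsRecord h y ∧ (m : ℤ) ∣ y - r := by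
  have hn' : (1 : ℤ) ≤ n := by exact_mod_cast hn
  have hm' : (1 : ℤ) ≤ m := by exact_mod_cast hm
  obtain ⟨k, hk⟩ : ∃ k : ℤ, r + k * n ≤ y := ⟨-|y - r|, by
    have := neg_abs_le (y - r)
    have := abs_nonneg (y - r)
    nlinarith⟩
  have hx := hL.spoke_add k hr
  have hdvd : (m : ℤ) ∣ y - r ↔ (m : ℤ) ∣ h y - h (r + k * n) := by
    have h1 := hH.dvd_sub_self y
    have h2 := hH.dvd_sub_self (r + k * n)
    have h3 : (m : ℤ) ∣ k * n := Dvd.dvd.mul_left (Int.natCast_dvd_natCast.2 hmn) k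
    rw [show y - r = (h y - h (r + k * n)) +
      ((h (r + k * n) - (r + k * n)) - (h y - y) + k * n) by ring]
    exact Int.dvd_add_left (dvd_add (dvd_sub h2 h1) h3)
  constructor
  · intro hy
    refine ⟨hF.isRecord hL hN hh hn hy, hdvd.2 ?_⟩
    obtain ⟨t, rfl⟩ := hF.exists_iterate_spoke hL hN hm hx hy hk
    rw [← Function.iterate_mul, hF.height_iterate hL hN hh]
    push_cast
    rw [add_sub_cancel_left]
    exact dvd_mul_right _ _
  · rintro ⟨hy, hyr⟩
    obtain ⟨q, hq⟩ := hdvd.1 hyr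
    have hle : h (r + k * n) ≤ h y := by
      rcases hk.eq_or_lt with h1 | h1
      · rw [h1]
      · exact (hy _ h1).le
    have hq0 : 0 ≤ q := by
      by_contra! hq0
      nlinarith
    obtain ⟨t, rfl⟩ := Int.eq_ofNat_of_zero_le hq0
    have hS := hF.spoke_iterate_iterate hx t
    -- The spoke reached after `t` blocks of `m` steps is a record of the same height as `y`, and
    -- records are determined by their height.
    have := hy.eq (hF.isRecord hL hN hh hn hS) (by
      rw [← Function.iterate_mul, hF.height_iterate hL hN hh]
      push_cast
      linarith)
    exact this ▸ hS

end IsFilled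

end

/-! ### Translation between sets of arcs and laminations. -/

/-- Two boundary points of the universal cover are joined by an edge or by an arc in `T`. -/
def IsJoined {n : ℕ} (T : Set (Arc n)) (a b : ℤ) : Prop := Joined T (a : WithTop ℤ) (b : WithTop ℤ)

/-- There is a spoke in `T` at the boundary point `x` of the universal cover. -/
def SpokeAt {n : ℕ} (T : Set (Arc n)) (x : ℤ) : Prop := Arc.spoke (x : ZMod n) ∈ T

section

variable {n : ℕ} {T T' : Set (Arc n)}

theorem isJoined_iff {a b : ℤ} : IsJoined T a b ↔ b = a + 1 ∨
    a < b ∧ b ≤ a + n ∧ ∃ h : (b : ZMod n) ≠ a + 1, Arc.chord (a : ZMod n) b h ∈ T := by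
  constructor
  · rintro (⟨c, hc, hc'⟩ | ⟨α, hα, hlift⟩)
    · have h1 : a = c := WithTop.coe_injective hc
      have h2 : b = c + 1 := WithTop.coe_injective hc'
      exact .inl (by omega)
    · cases α with
      | spoke i =>
        obtain ⟨c, -, hc, -⟩ := hlift
        exact absurd hc WithTop.coe_ne_top
      | chord i j hij =>
        obtain ⟨c, d, hc, hd, rfl, rfl, hcd, hdn⟩ := hlift
        obtain rfl : a = c := WithTop.coe_injective hc
        obtain rfl : b = d := WithTop.coe_injective hd
        exact .inr ⟨hcd, hdn, hij, hα⟩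
  · rintro (rfl | ⟨hab, hbn, h, hT⟩)
    · exact .inl ⟨a, rfl, rfl⟩
    · exact .inr ⟨_, hT, a, b, rfl, rfl, rfl, rfl, hab, hbn⟩

theorem joined_top_iff {x : ℤ} : Joined T (x : WithTop ℤ) ⊤ ↔ SpokeAt T x := by
  constructor
  · rintro (⟨c, hc, hc'⟩ | ⟨α, hα, hlift⟩)
    · exact absurd hc'.symm WithTop.coe_ne_top
    · cases α with
      | spoke i =>
        obtain ⟨c, hc, -, rfl⟩ := hlift
        obtain rfl : x = c := WithTop.coe_injective hc
        exact hα
      | chord i j hij =>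
        obtain ⟨c, d, hc, hd, -⟩ := hlift
        exact absurd hd.symm WithTop.coe_ne_top
  · exact fun h => .inr ⟨_, h, x, rfl, rfl, rfl⟩

theorem isJoined_add (k : ℤ) {a b : ℤ} (h : IsJoined T a b) : IsJoined T (a + k * n) (b + k * n) := by
  rw [isJoined_iff] at h ⊢
  rcases h with rfl | ⟨h1, h2, h3, h4⟩
  · exact .inl (by ring)
  · refine .inr ⟨by omega, by omega, ?_⟩
    have ha : ((a + k * n : ℤ) : ZMod n) = a := by simp
    have hb : ((b + k * n : ℤ) : ZMod n) = b := by simp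
    rw [ha, hb]
    exact ⟨h3, h4⟩

theorem spokeAt_add (k : ℤ) {x : ℤ} (h : SpokeAt T x) : SpokeAt T (x + k * n) := by
  have hx : ((x + k * n : ℤ) : ZMod n) = x := by simp
  rwa [SpokeAt, hx]

theorem isLamination (hn : 1 ≤ n) (hT : ∀ α ∈ T, ∀ β ∈ T, ¬ α.Crosses β) :
    IsLamination n (IsJoined T) (SpokeAt T) where
  lt {a b} h := by rw [isJoined_iff] at h; omega
  le_add {a b} h := by rw [isJoined_iff] at h; omega
  succ a := isJoined_iff.2 (.inl rfl)
  le_of_lt {a b c d} h1 h2 hac hcb := by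
    by_contra! hbd
    rcases h1 with h1 | ⟨α, hα, h1⟩
    · obtain ⟨x, hx, hx'⟩ := h1
      have h3 : a = x := WithTop.coe_injective hx
      have h4 : b = x + 1 := WithTop.coe_injective hx'
      omega
    rcases h2 with h2 | ⟨β, hβ, h2⟩
    · obtain ⟨x, hx, hx'⟩ := h2
      have h3 : c = x := WithTop.coe_injective hx
      have h4 : d = x + 1 := WithTop.coe_injective hx'
      omega
    exact hT α hα β hβ ⟨_, _, _, _, h1, h2, .inl ⟨by exact_mod_cast hac, by exact_mod_cast hcb,
      by exact_mod_cast hbd⟩⟩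
  le_spoke {a b x} h1 h2 hax := by
    by_contra! hxb
    rcases h1 with h1 | ⟨α, hα, h1⟩
    · obtain ⟨y, hy, hy'⟩ := h1
      have h3 : a = y := WithTop.coe_injective hy
      have h4 : b = y + 1 := WithTop.coe_injective hy'
      omega
    exact hT α hα _ h2 ⟨_, _, x, ⊤, h1, ⟨x, rfl, rfl, rfl⟩, .inl ⟨by exact_mod_cast hax,
      by exact_mod_cast hxb, WithTop.coe_lt_top b⟩⟩
  rel_add k := isJoined_add k
  spoke_add k := spokeAt_add k

theorem IsLamination.not_crosses (hL : IsLamination n (IsJoined T) (SpokeAt T)) :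
    ∀ α ∈ T, ∀ β ∈ T, ¬ α.Crosses β := by
  have key : ∀ p q r s, Joined T p q → Joined T r s → p < r → r < q → q < s → False := by
    intro p q r s h1 h2 hpr hrq hqs
    lift p to ℤ using (hpr.trans (hrq.trans hqs)).ne_top
    lift r to ℤ using (hrq.trans hqs).ne_top
    lift q to ℤ using hqs.ne_top
    rw [WithTop.coe_lt_coe] at hpr hrq
    induction s with
    | top =>
      have := hL.le_spoke h1 (joined_top_iff.1 h2) hpr
      omega
    | coe s =>
      rw [WithTop.coe_lt_coe] at hqs
      have := hL.le_of_lt h1 h2 hpr hrq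
      omega
  rintro α hα β hβ ⟨p, q, r, s, h1, h2, h3 | h3⟩
  · exact key p q r s (.inr ⟨α, hα, h1⟩) (.inr ⟨β, hβ, h2⟩) h3.1 h3.2.1 h3.2.2
  · exact key r s p q (.inr ⟨β, hβ, h2⟩) (.inr ⟨α, hα, h1⟩) h3.1 h3.2.1 h3.2.2

theorem isSubgon_map {W : Finset ℤ} :
    IsSubgon T (W.map ⟨_, WithTop.coe_injective⟩) ↔ IsGon (IsJoined T) W := by
  simp only [IsSubgon, IsGon, Finset.card_map, Finset.mem_map, Function.Embedding.coeFn_mk,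
    forall_exists_index, and_imp, forall_apply_eq_imp_iff₂, WithTop.coe_lt_coe, WithTop.coe_le_coe,
    IsJoined]

theorem isSubgon_insert_top {W : Finset ℤ} :
    IsSubgon T (insert ⊤ (W.map ⟨_, WithTop.coe_injective⟩)) ↔
      IsSpokeGon (IsJoined T) (SpokeAt T) W := by
  have hcard : (insert ⊤ (W.map ⟨_, WithTop.coe_injective⟩) : Finset (WithTop ℤ)).card =
      W.card + 1 := by
    rw [Finset.card_insert_of_notMem (by simp), Finset.card_map]
  simp only [IsSubgon, IsSpokeGon, hcard, Finset.mem_insert, Finset.mem_map,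
    Function.Embedding.coeFn_mk, forall_eq_or_imp, forall_exists_index, and_imp,
    forall_apply_eq_imp_iff₂, WithTop.coe_lt_coe, WithTop.coe_le_coe, not_top_lt, false_imp_iff,
    implies_true, true_and, WithTop.coe_lt_top, true_imp_iff, lt_irrefl, le_top, and_true,
    not_false_eq_true, and_false, top_le_iff, WithTop.coe_ne_top, false_and, or_false,
    joined_top_iff, not_lt, IsJoined]
  constructor
  · rintro ⟨h1, h2⟩
    exact ⟨by omega, fun p hp => (h2 p hp).2, fun p hp => (h2 p hp).1⟩
  · rintro ⟨h1, h2, h3⟩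
    exact ⟨by omega, fun p hp => ⟨h3 p hp, h2 p hp⟩⟩

theorem exists_eq_map (V : Finset (WithTop ℤ)) : ∃ W : Finset ℤ,
    V = W.map ⟨_, WithTop.coe_injective⟩ ∨ V = insert ⊤ (W.map ⟨_, WithTop.coe_injective⟩) := by
  refine ⟨V.preimage (↑) WithTop.coe_injective.injOn, ?_⟩
  by_cases hV : ⊤ ∈ V
  · right
    ext p
    induction p with
    | top => simpa using hV
    | coe p => simp
  · left
    ext p
    induction p with
    | top => simpa using hV
    | coe p => simp

/-- The puncture is itself a corner of a spoke polygon, which leaves `m + 1` on the boundary. -/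
theorem card_eq_iff {m : ℕ} : (∀ V, IsSubgon T V → V.card = m + 2) ↔
    (∀ W, IsGon (IsJoined T) W → W.card = m + 2) ∧
      ∀ W, IsSpokeGon (IsJoined T) (SpokeAt T) W → W.card = m + 1 := by
  have hcard : ∀ W : Finset ℤ, (insert ⊤ (W.map ⟨_, WithTop.coe_injective⟩) :
      Finset (WithTop ℤ)).card = W.card + 1 := fun W => by
    rw [Finset.card_insert_of_notMem (by simp), Finset.card_map]
  constructor
  · intro h
    refine ⟨fun W hW => ?_, fun W hW => ?_⟩
    · simpa using h _ (isSubgon_map.2 hW)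
    · have := h _ (isSubgon_insert_top.2 hW)
      rw [hcard] at this
      omega
  · rintro ⟨h1, h2⟩ V hV
    obtain ⟨W, rfl | rfl⟩ := exists_eq_map V
    · simpa using h1 W (isSubgon_map.1 hV)
    · rw [hcard, h2 W (isSubgon_insert_top.1 hV)]

theorem isAngulation_iff {m : ℕ} (hn : 1 ≤ n) (hm : 1 ≤ m) : IsAngulation (m + 2) T ↔
    IsLamination n (IsJoined T) (SpokeAt T) ∧ (∃ x, SpokeAt T x) ∧
      ∃ N, IsOuter (IsJoined T) N ∧ IsFilled m (IsJoined T) (SpokeAt T) N := by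
  constructor
  · rintro ⟨h1, ⟨i, hi⟩, h3⟩
    have hL := isLamination hn h1
    obtain ⟨x, rfl⟩ := ZMod.intCast_surjective i
    obtain ⟨N, hN⟩ := hL.exists_outer
    exact ⟨hL, ⟨x, hi⟩, N, hN, isFilled_of_card hL hN hn (card_eq_iff.1 h3).1 (card_eq_iff.1 h3).2⟩
  · rintro ⟨hL, ⟨x, hx⟩, N, hN, hF⟩
    exact ⟨hL.not_crosses, ⟨x, hx⟩, card_eq_iff.2 ⟨fun W hW => hF.card_gon hL hN hW,
      fun W hW => hF.card_spokeGon hL hN hm hW⟩⟩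

theorem numSpokes_eq : numSpokes T = {i : ZMod n | ∃ y : ℤ, (y : ZMod n) = i ∧ SpokeAt T y}.ncard := by
  rw [numSpokes]
  congr 1
  ext i
  simp only [Set.mem_ofPred_eq]
  constructor
  · intro hi
    obtain ⟨x, rfl⟩ := ZMod.intCast_surjective i
    exact ⟨x, rfl, hi⟩
  · rintro ⟨y, rfl, hy⟩
    exact hy

theorem exists_lift (hn : 1 ≤ n) {i j : ZMod n} (hij : j ≠ i + 1) :
    ∃ a b : ℤ, (a : ZMod n) = i ∧ (b : ZMod n) = j ∧ a + 1 < b ∧ b ≤ a + n := by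
  obtain ⟨a, rfl⟩ := ZMod.intCast_surjective i
  obtain ⟨c, rfl⟩ := ZMod.intCast_surjective j
  have h1 := Int.emod_nonneg (c - (a + 1)) (show (n : ℤ) ≠ 0 by omega)
  have h2 := Int.emod_lt_of_pos (c - (a + 1)) (show (0 : ℤ) < n by omega)
  have h3 := Int.emod_add_mul_ediv (c - (a + 1)) n
  have hb : ((a + 1 + (c - (a + 1)) % n : ℤ) : ZMod n) = c := by
    rw [show a + 1 + (c - (a + 1)) % n = c + -((c - (a + 1)) / n) * n by linarith]
    simp
  refine ⟨a, a + 1 + (c - (a + 1)) % n, rfl, hb, ?_, by omega⟩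
  refine lt_of_le_of_ne (by omega) fun h => hij ?_
  rw [← hb, ← h]
  push_cast
  ring

theorem eq_of_isJoined_of_spokeAt (hn : 1 ≤ n) (h : ∀ a b, IsJoined T a b ↔ IsJoined T' a b)
    (h' : ∀ x, SpokeAt T x ↔ SpokeAt T' x) : T = T' := by
  ext α
  cases α with
  | chord i j hij =>
    obtain ⟨a, b, rfl, rfl, h1, h2⟩ := exists_lift hn hij
    have : ∀ T : Set (Arc n), IsJoined T a b ↔ Arc.chord (a : ZMod n) b hij ∈ T := fun T => by
      rw [isJoined_iff]
      constructor
      · rintro (h3 | ⟨-, -, _, h3⟩)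
        · omega
        · exact h3
      · exact fun h3 => .inr ⟨by omega, h2, hij, h3⟩
    rw [← this, h, this]
  | spoke i =>
    obtain ⟨x, rfl⟩ := ZMod.intCast_surjective i
    exact h' x

/-- The arcs that are read off from a height function. -/
def arcsOf (n m : ℕ) (h : ℤ → ℤ) (r : ℤ) : Set (Arc n) := {α |
  match α with
  | .chord i j _ => ∃ a b : ℤ, (a : ZMod n) = i ∧ (b : ZMod n) = j ∧ Visible m h a b
  | .spoke i => ∃ x : ℤ, (x : ZMod n) = i ∧ IsRecord h x ∧ (m : ℤ) ∣ x - r}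

namespace IsHeight

variable {m : ℕ} {D : ℤ} {h : ℤ → ℤ}

theorem isJoined_arcsOf (hH : IsHeight m n D h) (hD : 0 < D) (hn : 1 ≤ n) (hmn : m ∣ n) (r : ℤ)
    (a b : ℤ) : IsJoined (arcsOf n m h r) a b ↔ Visible m h a b := by
  have hL := hH.isLamination hD hn hmn r
  rw [isJoined_iff]
  constructor
  · rintro (rfl | ⟨h1, h2, h3, c, d, hc, hd, hcd⟩)
    · exact hL.succ a
    · obtain ⟨k, hk⟩ := (ZMod.intCast_eq_intCast_iff_dvd_sub _ _ _).1 hc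
      obtain ⟨l, hl⟩ := (ZMod.intCast_eq_intCast_iff_dvd_sub _ _ _).1 hd
      have h4 := hL.lt hcd
      have h5 := hL.le_add hcd
      -- Both lengths `b - a` and `d - c` lie between `1` and `n`, so the two end points are moved
      -- by the same translation.
      have hkl : k = l := by
        have : |(n : ℤ) * (k - l)| < n := by
          rw [mul_sub, ← hk, ← hl, abs_lt]; constructor <;> linarith
        have := Int.eq_zero_of_abs_lt_dvd (Dvd.intro _ rfl) this
        rcases mul_eq_zero.1 this with h6 | h6 <;> omega
      subst hkl
      have := hL.rel_add k hcd
      rwa [show c + k * n = a by linarith, show d + k * n = b by linarith] at this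
  · intro hab
    by_cases hb : b = a + 1
    · exact .inl hb
    · have h1 := hL.lt hab
      have h2 := hL.le_add hab
      refine .inr ⟨h1, h2, fun h3 => ?_, a, b, rfl, rfl, hab⟩
      have h4 : ((a + 1 : ℤ) : ZMod n) = b := by push_cast; exact h3.symm
      have h5 := Int.le_of_dvd (by omega) ((ZMod.intCast_eq_intCast_iff_dvd_sub _ _ _).1 h4)
      omega

theorem spokeAt_arcsOf (hH : IsHeight m n D h) (hD : 0 < D) (hn : 1 ≤ n) (hmn : m ∣ n) (r : ℤ)
    (x : ℤ) : SpokeAt (arcsOf n m h r) x ↔ IsRecord h x ∧ (m : ℤ) ∣ x - r := by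
  have hL := hH.isLamination hD hn hmn r
  constructor
  · rintro ⟨c, hc, hS⟩
    obtain ⟨k, hk⟩ := (ZMod.intCast_eq_intCast_iff_dvd_sub _ _ _).1 hc
    have := hL.spoke_add k hS
    rwa [show c + k * n = x by linarith] at this
  · exact fun hx => ⟨x, rfl, hx⟩

theorem isAngulation_arcsOf (hH : IsHeight m n D h) (hD : 0 < D) (hn : 1 ≤ n) (hm : 1 ≤ m)
    (hmn : m ∣ n) (r : ℤ) : IsAngulation (m + 2) (arcsOf n m h r) := by
  have h1 : IsJoined (arcsOf n m h r) = Visible m h := by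
    ext a b; exact hH.isJoined_arcsOf hD hn hmn r a b
  have h2 : SpokeAt (arcsOf n m h r) = fun x => IsRecord h x ∧ (m : ℤ) ∣ x - r := by
    ext x; exact hH.spokeAt_arcsOf hD hn hmn r x
  rw [isAngulation_iff hn hm, h1, h2]
  have hL := hH.isLamination hD hn hmn r
  obtain ⟨N, hN⟩ := hL.exists_outer
  exact ⟨hL, hH.exists_spoke hD hn r, N, hN, hH.isFilled hD hn hm hmn r hN⟩

end IsHeight

end

/-! ### The height function of a degree sequence, and the count. -/

/-- The signed sum of `g` over the integers between `0` and `x`. -/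
noncomputable def signedSum (g : ℤ → ℤ) (x : ℤ) : ℤ := ∑ c ∈ Finset.Ico 0 x, g c - ∑ c ∈ Finset.Ico x 0, g c

theorem signedSum_succ (g : ℤ → ℤ) (x : ℤ) : signedSum g (x + 1) = signedSum g x + g x := by
  simp only [signedSum]
  rcases le_or_gt 0 x with h | h
  · rw [← Finset.insert_Ico_right_eq_Ico_add_one h, Finset.sum_insert (by simp),
      Finset.Ico_eq_empty_of_le h, Finset.Ico_eq_empty_of_le (by omega : 0 ≤ x + 1)]
    ring
  · rw [← Finset.insert_Ico_add_one_left_eq_Ico h, Finset.sum_insert (by simp),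
      Finset.Ico_eq_empty_of_le h.le, Finset.Ico_eq_empty_of_le (by omega : x + 1 ≤ 0)]
    ring

/-- The height function of an angulation with `f i` polygons starting at the boundary vertex `i`. -/
noncomputable def height {n : ℕ} (m : ℕ) (f : ZMod n → ℕ) (x : ℤ) : ℤ :=
  x - m * signedSum (fun c => f c) x

section

variable {n m : ℕ} {f : ZMod n → ℕ}

theorem height_succ (x : ℤ) : height m f (x + 1) = height m f x + 1 - m * f x := by
  simp only [height, signedSum_succ]
  ring

theorem sum_Ico_eq [NeZero n] : ∑ c ∈ Finset.Ico (0 : ℤ) n, (f c : ℤ) = ∑ i, (f i : ℤ) := by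
  refine Finset.sum_nbij (fun c : ℤ => (c : ZMod n)) (fun _ _ => Finset.mem_univ _) ?_ ?_
    fun _ _ => rfl
  · intro a ha b hb hab
    simp only [Finset.coe_Ico, Set.mem_Ico] at ha hb
    have := (ZMod.intCast_eq_intCast_iff_dvd_sub _ _ _).1 hab
    have := Int.eq_zero_of_abs_lt_dvd this (by rw [abs_lt]; constructor <;> omega)
    omega
  · intro i _
    exact ⟨i.val, Finset.mem_coe.2 (Finset.mem_Ico.2
      ⟨by positivity, by exact_mod_cast ZMod.val_lt i⟩), by simp⟩

theorem isHeight_height [NeZero n] :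
    IsHeight m n (n - m * ∑ i, (f i : ℤ)) (height m f) where
  le_succ x := by
    rw [height_succ]
    have : (0 : ℤ) ≤ m * f x := by positivity
    omega
  dvd_sub_self x := ⟨-signedSum (fun c => f c) x, by simp only [height]; ring⟩
  add_period x := by
    have hstep : ∀ y : ℤ, height m f (y + 1 + n) - height m f (y + 1) =
        height m f (y + n) - height m f y := fun y => by
      rw [show y + 1 + (n : ℤ) = y + n + 1 by ring, height_succ, height_succ]
      simp
    suffices height m f (x + n) - height m f x = n - m * ∑ i, (f i : ℤ) by linarith
    induction x with
    | zero =>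
      simp [height, signedSum, ← sum_Ico_eq (f := f)]
    | succ k ih => rw [hstep, ih]
    | pred k ih => rw [← hstep, sub_add_cancel, ih]

theorem IsLamination.outDegree_add {R : ℤ → ℤ → Prop} {S : ℤ → Prop} (hL : IsLamination n R S)
    (a k : ℤ) : outDegree R (a + k * n) = outDegree R a := by
  have : {b | a + k * n + 1 < b ∧ R (a + k * n) b} = (· + k * n) '' {b | a + 1 < b ∧ R a b} := by
    ext b
    simp only [Set.mem_ofPred_eq, Set.mem_image]
    constructor
    · rintro ⟨h1, h2⟩
      refine ⟨b - k * n, ⟨by omega, ?_⟩, by ring⟩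
      have := hL.rel_add (-k) h2
      rwa [show a + k * n + -k * n = a by ring, show b + -k * n = b - k * n by ring] at this
    · rintro ⟨c, ⟨h1, h2⟩, rfl⟩
      exact ⟨by omega, hL.rel_add k h2⟩
  rw [outDegree, this, Set.ncard_image_of_injective _ (add_left_injective _), outDegree]

theorem IsLamination.outDegree_val [NeZero n] {R : ℤ → ℤ → Prop} {S : ℤ → Prop}
    (hL : IsLamination n R S) (a : ℤ) : outDegree R ((a : ZMod n).val : ℤ) = outDegree R a := by
  have := hL.outDegree_add ((a : ZMod n).val : ℤ) (a / n)
  rw [ZMod.val_intCast, mul_comm, Int.emod_add_mul_ediv] at this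
  rw [this, ZMod.val_intCast]

theorem card_piAntidiag_univ (ι : Type*) [Fintype ι] [DecidableEq ι] (k : ℕ) :
    (Finset.piAntidiag (Finset.univ : Finset ι) k).card = (Fintype.card ι + k - 1).choose k := by
  rw [← Finset.map_sym_eq_piAntidiag, Finset.card_map, Finset.sym_univ, Finset.card_univ,
    Sym.card_sym_eq_choose]

theorem numSpokes_add_sum [NeZero n] {ℓ : ℕ} (hm : 1 ≤ m) (hn : n = m * ℓ) {T : Set (Arc n)}
    (hT : IsAngulation (m + 2) T) (hf : ∀ a : ℤ, f a = outDegree (IsJoined T) a) :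
    numSpokes T + ∑ i, f i = ℓ ∧ 0 < (n : ℤ) - m * ∑ i, (f i : ℤ) := by
  have hn1 : 1 ≤ n := NeZero.one_le
  obtain ⟨hL, ⟨x, hx⟩, N, hN, hF⟩ := (isAngulation_iff hn1 hm).1 hT
  obtain ⟨h1, h2⟩ := hF.ncard_spokes hL hN (h := height m f)
    (fun x => by rw [height_succ, hf]) isHeight_height hn1 hm hx
  refine ⟨?_, h2⟩
  rw [← numSpokes_eq] at h1
  have h3 : (m : ℤ) * (numSpokes T + ∑ i, (f i : ℤ)) = m * ℓ := by
    rw [mul_add, ← h1, sub_add_cancel]; exact_mod_cast hn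
  have h4 := mul_left_cancel₀ (show (m : ℤ) ≠ 0 by omega) h3
  exact_mod_cast h4

theorem IsAngulation.exists_eq_arcsOf [NeZero n] (hm : 1 ≤ m) (hmn : m ∣ n)
    {T : Set (Arc n)} (hT : IsAngulation (m + 2) T) (hf : ∀ a : ℤ, f a = outDegree (IsJoined T) a)
    (hD : 0 < (n : ℤ) - m * ∑ i, (f i : ℤ)) :
    ∃ r < m, T = arcsOf n m (height m f) r := by
  have hn1 : 1 ≤ n := NeZero.one_le
  obtain ⟨hL, ⟨x, hx⟩, N, hN, hF⟩ := (isAngulation_iff hn1 hm).1 hT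
  have hh : ∀ x, height m f (x + 1) = height m f x + 1 - m * outDegree (IsJoined T) x :=
    fun x => by rw [height_succ, hf]
  have hH := isHeight_height (m := m) (f := f)
  have hm0 : (m : ℤ) ≠ 0 := by omega
  have h1 := Int.emod_nonneg x hm0
  have h2 := Int.emod_lt_of_pos x (show (0 : ℤ) < m by omega)
  -- Any spoke `x` determines the class.
  refine ⟨(x % m).toNat, by omega, ?_⟩
  rw [Int.toNat_of_nonneg h1]
  refine eq_of_isJoined_of_spokeAt hn1 (fun a b => ?_) fun y => ?_
  · rw [hH.isJoined_arcsOf hD hn1 hmn, hF.rel_iff_visible hL hN hh hH hD hn1 hm hmn]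
  · rw [hH.spokeAt_arcsOf hD hn1 hmn, hF.spoke_iff hL hN hh hH hn1 hm hmn hx]
    have h3 : (m : ℤ) ∣ x - x % m := Int.dvd_self_sub_emod
    rw [show y - x % m = y - x + (x - x % m) by ring, Int.dvd_add_left h3]

end

end PuncturedPolygon

open PuncturedPolygon in
theorem theorem3p4 (m ℓ n s : ℕ) (hm : 1 ≤ m) (hn : n = m * ℓ) (hs : 1 ≤ s) (hsl : s ≤ ℓ) :
    {T : Set (PuncturedPolygon.Arc n) |
        PuncturedPolygon.IsAngulation (m + 2) T ∧ PuncturedPolygon.numSpokes T = s}.ncard =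
      m * (n + ℓ - s - 1).choose (n - 1) := by
  have hn1 : 1 ≤ n := by
    rw [hn]; exact Nat.mul_pos hm (hs.trans hsl)
  have : NeZero n := ⟨by omega⟩
  have hmn : m ∣ n := ⟨ℓ, hn⟩
  set A := Finset.piAntidiag (Finset.univ : Finset (ZMod n)) (ℓ - s) ×ˢ Finset.range m with hA
  have hmemA : ∀ x : (ZMod n → ℕ) × ℕ, x ∈ A ↔ ∑ i, x.1 i = ℓ - s ∧ x.2 < m := by
    simp [hA]
  have hpos : ∀ x ∈ A, 0 < (n : ℤ) - m * ∑ i, (x.1 i : ℤ) := by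
    intro x hx
    have h1 : ∑ i, (x.1 i : ℤ) = ℓ - s := by
      have := ((hmemA x).1 hx).1
      rw [← Nat.cast_sum, this]
      push_cast [hsl]
      ring
    rw [h1, hn]
    push_cast
    have : (0 : ℤ) < m * s := by exact_mod_cast Nat.mul_pos hm hs
    linarith
  have hdeg : ∀ x ∈ A, ∀ a : ℤ,
      x.1 a = outDegree (IsJoined (arcsOf n m (height m x.1) x.2)) a := by
    intro x hx a
    have hH := isHeight_height (m := m) (f := x.1)
    have h1 : IsJoined (arcsOf n m (height m x.1) x.2) = Visible m (height m x.1) := by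
      ext a b; exact hH.isJoined_arcsOf (hpos x hx) hn1 hmn _ a b
    rw [h1, hH.outDegree_visible (hpos x hx) hn1 hm (height_succ a)]
  have hset : {T : Set (Arc n) | IsAngulation (m + 2) T ∧ numSpokes T = s} =
      (fun x : (ZMod n → ℕ) × ℕ => arcsOf n m (height m x.1) x.2) '' A := by
    ext T
    simp only [Set.mem_ofPred_eq, Set.mem_image, SetLike.mem_coe]
    constructor
    · rintro ⟨hT, hTs⟩
      obtain ⟨f, hf⟩ : ∃ f : ZMod n → ℕ, ∀ a : ℤ, f a = outDegree (IsJoined T) a :=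
        ⟨fun i => outDegree (IsJoined T) i.val, ((isAngulation_iff hn1 hm).1 hT).1.outDegree_val⟩
      obtain ⟨h1, h2⟩ := numSpokes_add_sum hm hn hT hf
      obtain ⟨r, hr, hTr⟩ := hT.exists_eq_arcsOf hm hmn hf h2
      exact ⟨(f, r), (hmemA _).2 ⟨by dsimp only; omega, hr⟩, hTr.symm⟩
    · rintro ⟨x, hx, rfl⟩
      have hT := isHeight_height.isAngulation_arcsOf (hpos x hx) hn1 hm hmn x.2
      have h1 := (numSpokes_add_sum hm hn hT (hdeg x hx)).1
      have h2 := ((hmemA x).1 hx).1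
      exact ⟨hT, by omega⟩
  -- The set of arcs gives back `f` as its out-degrees and the residue as the class of any of its
  -- spokes.
  have hinj : Set.InjOn (fun x : (ZMod n → ℕ) × ℕ => arcsOf n m (height m x.1) x.2) A := by
    rintro ⟨f, r⟩ hx ⟨g, t⟩ hy hxy
    simp only [SetLike.mem_coe] at hx hy hxy
    obtain rfl : f = g := by
      ext i
      obtain ⟨a, rfl⟩ := ZMod.intCast_surjective i
      have h1 := hdeg _ hx a
      have h2 := hdeg _ hy a
      simp only at h1 h2
      rw [h1, h2, hxy]
    have hH := isHeight_height (m := m) (f := f)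
    have hD := hpos _ hx
    obtain ⟨y, hy1⟩ := hH.exists_spoke hD hn1 r
    have hy2 := (hH.spokeAt_arcsOf hD hn1 hmn r y).2 hy1
    rw [hxy, hH.spokeAt_arcsOf hD hn1 hmn] at hy2
    have h1 := dvd_sub hy1.2 hy2.2
    have h2 := ((hmemA _).1 hx).2
    have h3 := ((hmemA _).1 hy).2
    simp only at h2 h3
    have := Int.eq_zero_of_abs_lt_dvd h1 (by rw [abs_lt]; constructor <;> omega)
    simp only [Prod.mk.injEq, true_and]
    omega
  rw [hset, hinj.ncard_image, Set.ncard_coe_finset, hA, Finset.card_product, Finset.card_range,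
    card_piAntidiag_univ, ZMod.card, mul_comm]
  congr 1
  rw [show n + ℓ - s - 1 = n + (ℓ - s) - 1 by omega]
  exact Nat.choose_symm_of_eq_add (by omega)
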